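/- Let $m\ge 1$ and $p_1,\dots,p_m\in\mathbb N$, let $\mathcal X$ be a measurable space, $\mathcal Z:=[p_1]\times\dots\times[p_m]$, and let $\mathcal D$ be a probability distribution of $(X,Y,Z)$, $Z=(Z^{(1)},\dots,Z^{(m)})$, on $\mathcal X\times\{0,1\}\times\mathcal Z$ (features, binary label, $m$ protected attributes, which need not be distinct). Let $\mathcal F\subseteq\{0,1\}^{\mathcal X\times\mathcal Z}$ be a class of measurable classifiers of VC dimension $d\in\mathbb N$. Assume that $\mathcal F$ is a measurable class in the usual sense of empirical process theory: for all $n$ and $e\in\mathbb R^n$, the map $(a_1,\dots,a_n)\mapsto\sup_{f\in\mathcal F}|\sum_i e_i f(a_i)|$ is measurable with respect to the completion of the $n$-fold product of the law of $(X,Z)$. For a distribution $\mathcal P$ on $\mathcal X\times\{0,1\}\times\mathcal Z$ put $\mathrm{Err}_{\mathcal P}(f):=\Pr_{\mathcal P}[f(X,Z)\ne Y]$. For each $r\in[m]$ fix two events $\mathcal E^{(r)}(f)$, $\mathcal E'^{(r)}(f)$, each a measurable condition on the prediction $f(X,Z)$ and the data point $(X,Y,Z)$, and let $$q^{(r)}_{\ell,\mathcal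 P}(f):=\Pr\nolimits_{\mathcal P}[\mathcal E^{(r)}(f)\mid \mathcal E'^{(r)}(f), Z^{(r)}=\ell],\qquad \Omega^{(r)}_{\mathcal P}(f):=\frac{\min_{\ell\in[p_r]}q^{(r)}_{\ell,\mathcal P}(f)}{\max_{\ell\in[p_r]}q^{(r)}_{\ell,\mathcal P}(f)}$$ (a quotient with denominator $0$, including a conditional probability given a null event, counts as $0$). Let $\tau\in(0,1]$, and let $f^\star$ minimize $\mathrm{Err}_{\mathcal D}$ over all $f\in\mathcal F$ with $\Omega^{(r)}_{\mathcal D}(f)\ge\tau$ for all $r\in[m]$. Suppose that, for a constant $\lambda>0$, $$\Pr\nolimits_{\mathcal D}[\mathcal E^{(r)}(f^\star),\mathcal E'^{(r)}(f^\star),Z^{(r)}=\ell]\ge\lambda\qquad\text{for all } r\in[m],\ \ell\in[p_r].$$ Let $\eta\in(0,\lambda/2)$, $\varepsilon>2\eta$, $\nu>\frac{8\eta\tau}{\lambda-2\eta}$, $\delta\in(0,1)$, and let $$0<\Delta\le\tfrac1{96}\min\Big\{\varepsilon-2\eta,\ (\lambda-2\eta)\Big(\nu-\frac{8\eta\tau}{\lambda-2\eta}\Big),\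 \lambda-2\eta\Big\}.$$ Draw $N$ iid samples $(x_i,y_i,z_i)$ from $\mathcal D$. An adversary, who may be randomized and may know everything, replaces the protected attributes $z_i$ of at most $\eta N$ of the samples by arbitrary values; let $\widehat D$ be the empirical distribution of the perturbed samples $(x_i,y_i,\widehat z_i)$. Consider the program (General-ErrTolerant): $$\min_{f\in\mathcal F}\mathrm{Err}_{\widehat D}(f)\quad\text{s.t., for all } r\in[m],\ \ell\in[p_r]:\quad \Omega^{(r)}_{\widehat D}(f)\ge\tau\Big(\frac{1-(\eta+\Delta)/\lambda}{1+(\eta+\Delta)/\lambda}\Big)^2,\quad \Pr\nolimits_{\widehat D}[\mathcal E^{(r)}(f),\mathcal E'^{(r)}(f),Z^{(r)}=\ell]\ge\lambda-\eta-\Delta.$$ Then there is a universal polynomial $Q$ in three variables (independent of all the data above) such that, whenever $N\ge Q\big(d,\tfrac1\Delta,\log(\delta^{-1}\sum_{i\in[m]}p_i)\big)$, with probability at least $1-\delta$ the program has an optimal solution, and every optimal solution $f_{\rm ET}$ satisfies $$\mathrm{Err}_{\mathcal D}(f_{\rm ET})-\mathrm{Err}_{\mathcal D}(f^\star)\le\varepsilon\qquad\text{and}\qquad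 \Omega^{(r)}_{\mathcal D}(f_{\rm ET})\ge\tau-\nu\ \text{ for all } r\in[m].$$ -/

import Mathlib

open MeasureTheory ProbabilityTheory

noncomputable section

namespace FairClass

/-- Joint values of the `m` protected attributes; the `r`-th one takes `p r` values. -/
abbrev Attr {m : ℕ} (p : Fin m → ℕ) : Type := (r : Fin m) → Fin (p r)

/-- Data points `(x, y, z)`: features, binary label, protected attributes. -/
abbrev Data (X : Type*) {m : ℕ} (p : Fin m → ℕ) : Type _ := X × Bool × Attr p

/-- Binary classifiers; a prediction may use the features and the protected attributes. -/
abbrev Classifier (X : Type*) {m : ℕ} (p : Fin m → ℕ) : Type _ := X × Attr p → Bool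

variable {X : Type*} {m : ℕ} {p : Fin m → ℕ}

/-- The part of a data point that is visible to a classifier. -/
def inputOf (w : Data X p) : X × Attr p := (w.1, w.2.2)

/-- The prediction of `f` at a data point. -/
def predict (f : Classifier X p) (w : Data X p) : Bool := f (inputOf w)

/-- The event, determined by the prediction of the classifier and by the data point,
that belongs to a set of pairs (prediction, data point). -/
def event (E : Set (Bool × Data X p)) (f : Classifier X p) : Set (Data X p) :=
  {w | (predict f w, w) ∈ E}

/-- The event that the `r`-th protected attribute equals `l`. -/
def group (X : Type*) {m : ℕ} (p : Fin m → ℕ) (r : Fin m) (l : Fin (p r)) : Set (Data X p) :=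
  {w | w.2.2 r = l}

/-- `S'` arises from `S` by changing the protected attributes of at most `η * N` samples. -/
def IsHammingPerturbation (η : ℝ) {N : ℕ} (S S' : Fin N → Data X p) : Prop :=
  (∀ i, (S' i).1 = (S i).1 ∧ (S' i).2.1 = (S i).2.1) ∧
    ((Finset.univ.filter fun i => (S' i).2.2 ≠ (S i).2.2).card : ℝ) ≤ η * N

/-- A linear-fractional performance metric, given by its events `ℰ(f)` and `ℰ'(f)`.
If membership in `cond` does not depend on the prediction, the metric is linear. -/
structure PerfMetric (X : Type*) [MeasurableSpace X] {m : ℕ} (p : Fin m → ℕ) where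
  main : Set (Bool × Data X p)
  cond : Set (Bool × Data X p)
  measurableSet_main : MeasurableSet main
  measurableSet_cond : MeasurableSet cond

variable [MeasurableSpace X]

/-- Predictive error `Pr_D[f(X, Z) ≠ Y]`. -/
def err (D : Measure (Data X p)) (f : Classifier X p) : ℝ :=
  D.real {w | predict f w ≠ w.2.1}

/-- `Pr_D[ℰ(f), ℰ'(f), Z⁽ʳ⁾ = l]`. -/
def jointProb (D : Measure (Data X p)) (M : PerfMetric X p) (r : Fin m) (f : Classifier X p)
    (l : Fin (p r)) : ℝ :=
  D.real (event M.main f ∩ event M.cond f ∩ group X p r l)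

/-- `q_l(f) = Pr_D[ℰ(f) | ℰ'(f), Z⁽ʳ⁾ = l]`. -/
def perf (D : Measure (Data X p)) (M : PerfMetric X p) (r : Fin m) (f : Classifier X p)
    (l : Fin (p r)) : ℝ :=
  jointProb D M r f l / D.real (event M.cond f ∩ group X p r l)

/-- The fairness metric `Ω⁽ʳ⁾_D(f) = min_l q_l(f) / max_l q_l(f)`. -/
def fairness (D : Measure (Data X p)) (M : PerfMetric X p) (r : Fin m) (f : Classifier X p) : ℝ :=
  (⨅ l, perf D M r f l) / (⨆ l, perf D M r f l)

/-- `f` minimizes the error under `D` over the set `C` of admissible classifiers. -/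
def IsErrMinimizer (D : Measure (Data X p)) (C : Set (Classifier X p)) (f : Classifier X p) :
    Prop :=
  f ∈ C ∧ IsMinOn (err D) C f

/-- The classifiers of `F` that satisfy every fairness constraint under `D`. -/
def fairSet (D : Measure (Data X p)) (M : Fin m → PerfMetric X p) (F : Set (Classifier X p))
    (τ : ℝ) : Set (Classifier X p) :=
  {f ∈ F | ∀ r, τ ≤ fairness D (M r) r f}

/-- The empirical distribution of a finite sample. -/
def empirical {N : ℕ} (S : Fin N → Data X p) : Measure (Data X p) :=
  (N : ENNReal)⁻¹ • ∑ i, Measure.dirac (S i)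

/-- The feasible set of the general error-tolerant program on the sample `S`. -/
def errTolerantSet {N : ℕ} (S : Fin N → Data X p) (M : Fin m → PerfMetric X p)
    (F : Set (Classifier X p)) (τ η lam Δ : ℝ) : Set (Classifier X p) :=
  {f ∈ F |
    (∀ r, τ * ((1 - (η + Δ) / lam) / (1 + (η + Δ) / lam)) ^ 2 ≤
      fairness (empirical S) (M r) r f) ∧
    (∀ r l, lam - η - Δ ≤ jointProb (empirical S) (M r) r f l)}

/-- `f` is an optimal solution of the general error-tolerant program on the sample `S`. -/
def IsErrTolerantSolution {N : ℕ} (S : Fin N → Data X p) (M : Fin m → PerfMetric X p)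
    (F : Set (Classifier X p)) (τ η lam Δ : ℝ) (f : Classifier X p) : Prop :=
  IsErrMinimizer (empirical S) (errTolerantSet S M F τ η lam Δ) f

/-- `F` shatters the finite set `B`. -/
def Shatters {α : Type*} (F : Set (α → Bool)) (B : Finset α) : Prop :=
  ∀ T ⊆ B, ∃ f ∈ F, ∀ a ∈ B, f a = true ↔ a ∈ T

/-- The VC dimension of `F` is `d`. -/
def HasVCDim {α : Type*} (F : Set (α → Bool)) (d : ℕ) : Prop :=
  IsGreatest {k : ℕ | ∃ B : Finset α, B.card = k ∧ Shatters F B} d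

/-- `F` is a `μ`-measurable class in the sense of empirical process theory: its members are
measurable, and each supremum of weighted sums over finite samples is measurable with respect to
the completed product measure. All countable and all pointwise separable classes are such. -/
structure IsMeasurableClass {α : Type*} [MeasurableSpace α] (μ : Measure α)
    (F : Set (α → Bool)) : Prop where
  measurable : ∀ f ∈ F, Measurable f
  aemeasurable_iSup : ∀ (n : ℕ) (e : Fin n → ℝ),
    AEMeasurable (fun a : Fin n → α => ⨆ f : F, |∑ i, e i * (if f.1 (a i) then 1 else 0)|)
      (Measure.pi fun _ => μ)

end FairClass

end

noncomputable section

namespace FairClass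

/-! ### Growth of classes of bounded VC dimension -/

/-! The program sees the data only through the error event and, for each pair `(r, l)`, the events
with probabilities `Pr[ℰ, ℰ', Z⁽ʳ⁾ = l]` and `Pr[ℰ', Z⁽ʳ⁾ = l]`. The clean sample represents all of
these up to `Δ`, uniformly over `F`, with probability at least `1 - δ`. Changing at most `ηN`
attributes moves each empirical probability by at most `η`, whatever the adversary does. So on one
event of the clean sample all errors are at most `κ = η + Δ`, and the rest is deterministic
(`errTolerant_of_representative`).

Uniform convergence is the Vapnik–Chervonenkis argument: compare with a ghost sample
(`measure_exists_deviation_le`), replace the double sample by random swaps, that is, random signs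
(`measure_doubleDeviation_le`), and combine Sauer–Shelah with a Chernoff bound
(`card_signs_exists_le`). An indicator `1[(f, w) ∈ E]` is affine in `f` with coefficients depending
on `w` and values in `{-1, 0, 1}`, so the VC dimension and the measurability of `F` itself suffice
for every `E`.

In the deterministic part, joint probabilities bounded below turn additive errors into relative ones
(`ratio_stable`), so `Ω` changes by at most a squared factor (`fairness_stable`). Applied from `D`
to the sample, this makes `fstar` feasible, so an optimal solution has error at most `2κ` above that
of `fstar`. Applied from the sample back to `D` with lower bound `lam - κ`, it gives fairness at
least `τ(1 - 8κ/lam) ≥ τ - ν`. -/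

theorem sum_choose_le_pow (n d : ℕ) : ∑ k ∈ Finset.Iic d, n.choose k ≤ (n + 1) ^ d := by
  rw [← Nat.range_succ_eq_Iic]
  induction d with
  | zero => simp
  | succ d ih =>
    rw [Finset.sum_range_succ]
    have h1 : n.choose (d + 1) ≤ n * (n + 1) ^ d := by
      calc n.choose (d + 1) ≤ n ^ (d + 1) := Nat.choose_le_pow _ _
        _ = n * n ^ d := by ring
        _ ≤ n * (n + 1) ^ d := by gcongr; omega
    calc _ ≤ (n + 1) ^ d + n * (n + 1) ^ d := add_le_add ih h1
      _ = (n + 1) ^ (d + 1) := by ring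

section Traces

variable {A ι : Type*} [Fintype ι]

open Classical in
/-- The subsets of the index set that the members of `F` cut out on the points `b`. -/
def traces (F : Set (A → Bool)) (b : ι → A) : Finset (Finset ι) :=
  Finset.univ.filter fun T => ∃ f ∈ F, T = Finset.univ.filter fun i => f (b i) = true

theorem mem_traces {F : Set (A → Bool)} {b : ι → A} {T : Finset ι} :
    T ∈ traces F b ↔ ∃ f ∈ F, T = Finset.univ.filter fun i => f (b i) = true := by
  simp [traces]

/-- Two indices of a shattered set can be separated by a trace, so `b` takes different values at
them. Hence `b` maps `J` bijectively onto a set of points shattered by `F`. -/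
theorem card_le_of_shatters_traces [DecidableEq ι] {F : Set (A → Bool)} {d : ℕ}
    (hd : ∀ B : Finset A, Shatters F B → B.card ≤ d) (b : ι → A) {J : Finset ι}
    (hJ : (traces F b).Shatters J) : J.card ≤ d := by
  classical
  have key : ∀ T ⊆ J, ∃ f ∈ F, ∀ i ∈ J, f (b i) = true ↔ i ∈ T := by
    intro T hT
    obtain ⟨u, hu, hJu⟩ := hJ hT
    obtain ⟨f, hf, rfl⟩ := mem_traces.1 hu
    refine ⟨f, hf, fun i hi => ?_⟩
    rw [← hJu]
    simp [hi]
  have hinj : Set.InjOn b J := by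
    intro i hi j hj hij
    obtain ⟨f, -, hf⟩ := key {i} (by simpa using hi)
    have h1 := (hf i hi).2 (by simp)
    rw [hij] at h1
    exact (Finset.mem_singleton.1 ((hf j hj).1 h1)).symm
  rw [← Finset.card_image_of_injOn hinj]
  refine hd _ fun T hT => ?_
  obtain ⟨f, hf, hfJ⟩ := key (J.filter fun i => b i ∈ T) (Finset.filter_subset _ _)
  refine ⟨f, hf, fun a ha => ?_⟩
  obtain ⟨i, hi, rfl⟩ := Finset.mem_image.1 ha
  rw [hfJ i hi]
  simp [hi]

/-- The **Sauer–Shelah lemma** for the traces of a class on a finite family of points. -/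
theorem card_traces_le {F : Set (A → Bool)} {d : ℕ}
    (hd : ∀ B : Finset A, Shatters F B → B.card ≤ d) (b : ι → A) :
    (traces F b).card ≤ (Fintype.card ι + 1) ^ d := by
  classical
  have hvc : (traces F b).vcDim ≤ d :=
    Finset.sup_le fun J hJ => card_le_of_shatters_traces hd b (Finset.mem_shatterer.1 hJ)
  calc (traces F b).card ≤ (traces F b).shatterer.card := Finset.card_le_card_shatterer _
    _ ≤ ∑ k ∈ Finset.Iic (traces F b).vcDim, (Fintype.card ι).choose k :=
      Finset.card_shatterer_le_sum_vcDim
    _ ≤ ∑ k ∈ Finset.Iic d, (Fintype.card ι).choose k :=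
      Finset.sum_le_sum_of_subset (Finset.Iic_subset_Iic.2 hvc)
    _ ≤ _ := sum_choose_le_pow _ _

end Traces

/-! ### Random signs -/

/-- The sign `1` or `-1` that encodes a Boolean. -/
def sgn (b : Bool) : ℝ := if b then 1 else -1

section Signs

variable {ι : Type*} [Fintype ι] [DecidableEq ι]

/-- The sum over sign patterns factors over the coordinates, and each factor is `2 cosh (t c i) ≤ 2
exp (t² c i² / 2)`. -/
theorem sum_exp_signs_le (c : ι → ℝ) (hc : ∀ i, |c i| ≤ 2) (t : ℝ) :
    ∑ σ : ι → Bool, Real.exp (t * ∑ i, sgn (σ i) * c i) ≤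
      2 ^ Fintype.card ι * Real.exp (2 * Fintype.card ι * t ^ 2) := by
  have h1 : ∑ σ : ι → Bool, Real.exp (t * ∑ i, sgn (σ i) * c i) =
      ∏ i, ∑ b : Bool, Real.exp (t * (sgn b * c i)) := by
    rw [Fintype.prod_sum]
    refine Finset.sum_congr rfl fun σ _ => ?_
    rw [Finset.mul_sum, Real.exp_sum]
  have h2 : ∀ i, ∑ b : Bool, Real.exp (t * (sgn b * c i)) ≤ 2 * Real.exp (2 * t ^ 2) := by
    intro i
    have h3 := Real.cosh_le_exp_half_sq (t * c i)
    have h4 : Real.exp ((t * c i) ^ 2 / 2) ≤ Real.exp (2 * t ^ 2) := by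
      apply Real.exp_le_exp.2
      have : c i ^ 2 ≤ 2 ^ 2 := sq_le_sq' (abs_le.1 (hc i)).1 (abs_le.1 (hc i)).2
      nlinarith [sq_nonneg t]
    rw [Real.cosh_eq] at h3
    simp only [Fintype.sum_bool, sgn, if_true, Bool.false_eq_true, if_false, one_mul, neg_mul,
      mul_neg]
    linarith
  rw [h1]
  calc _ ≤ ∏ _i : ι, 2 * Real.exp (2 * t ^ 2) :=
        Finset.prod_le_prod (fun i _ => by positivity) fun i _ => h2 i
    _ = _ := by
      rw [Finset.prod_const, mul_pow, ← Real.exp_nat_mul, Finset.card_univ]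
      ring_nf

theorem card_signs_sum_gt_le (c : ι → ℝ) (hc : ∀ i, |c i| ≤ 2) {u : ℝ} (hu : 0 ≤ u) :
    ((Finset.univ.filter fun σ : ι → Bool => u < ∑ i, sgn (σ i) * c i).card : ℝ) ≤
      2 ^ Fintype.card ι * Real.exp (-(u ^ 2 / (8 * Fintype.card ι))) := by
  set K : ℝ := (Fintype.card ι : ℝ) with hK
  -- This minimizes the Chernoff exponent `2Kt² - tu`. For `K = 0` it is `0`, and the claimed bound
  -- is then `1`.
  set t : ℝ := u / (4 * K) with ht
  have ht0 : 0 ≤ t := by positivity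
  have h1 : ((Finset.univ.filter fun σ : ι → Bool => u < ∑ i, sgn (σ i) * c i).card : ℝ) *
      Real.exp (t * u) ≤ 2 ^ Fintype.card ι * Real.exp (2 * K * t ^ 2) := by
    refine le_trans ?_ (sum_exp_signs_le c hc t)
    rw [← nsmul_eq_mul, ← Finset.sum_const]
    refine le_trans (Finset.sum_le_sum fun σ hσ => ?_)
      (Finset.sum_le_sum_of_subset_of_nonneg (Finset.filter_subset _ _)
        fun σ _ _ => (Real.exp_pos _).le)
    exact Real.exp_le_exp.2
      (mul_le_mul_of_nonneg_left (Finset.mem_filter.1 hσ).2.le ht0)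
  rw [← le_div_iff₀ (Real.exp_pos _), mul_div_assoc, ← Real.exp_sub] at h1
  refine h1.trans_eq ?_
  congr 2
  rcases eq_or_ne K 0 with h0 | h0
  · simp [ht, h0]
  · rw [ht]; field_simp; ring

theorem card_signs_abs_sum_gt_le (c : ι → ℝ) (hc : ∀ i, |c i| ≤ 2) {u : ℝ} (hu : 0 ≤ u) :
    ((Finset.univ.filter fun σ : ι → Bool => u < |∑ i, sgn (σ i) * c i|).card : ℝ) ≤
      2 ^ Fintype.card ι * (2 * Real.exp (-(u ^ 2 / (8 * Fintype.card ι)))) := by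
  have h1 := card_signs_sum_gt_le c hc hu
  have h2 := card_signs_sum_gt_le (fun i => -c i) (fun i => by simpa using hc i) hu
  have hsub : (Finset.univ.filter fun σ : ι → Bool => u < |∑ i, sgn (σ i) * c i|) ⊆
      (Finset.univ.filter fun σ : ι → Bool => u < ∑ i, sgn (σ i) * c i) ∪
      (Finset.univ.filter fun σ : ι → Bool => u < ∑ i, sgn (σ i) * -c i) := by
    intro σ hσ
    simp only [Finset.mem_union, Finset.mem_filter, Finset.mem_univ, true_and, mul_neg,
      Finset.sum_neg_distrib] at hσ ⊢
    exact lt_abs.1 hσ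
  have h3 := (Finset.card_le_card hsub).trans (Finset.card_union_le _ _)
  have h4 := (Nat.cast_le (α := ℝ)).2 h3
  push_cast at h4
  linarith

/-- The number of sign patterns for which some member of a class of bounded VC dimension has
a large signed sum of differences. -/
theorem card_signs_exists_le {A : Type*} {F : Set (A → Bool)} {d : ℕ}
    (hd : ∀ B : Finset A, Shatters F B → B.card ≤ d) (b : ι ⊕ ι → A) (e : ι ⊕ ι → ℝ)
    (he : ∀ j, |e j| ≤ 1) {u : ℝ} (hu : 0 ≤ u) :
    (Set.ncard {σ : ι → Bool | ∃ f ∈ F, u < |∑ i, sgn (σ i) *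
        (e (.inl i) * (if f (b (.inl i)) then 1 else 0) -
          e (.inr i) * (if f (b (.inr i)) then 1 else 0))|} : ℝ) ≤
      2 ^ Fintype.card ι * ((2 * Fintype.card ι + 1) ^ d *
        (2 * Real.exp (-(u ^ 2 / (8 * Fintype.card ι))))) := by
  classical
  -- The coefficients depend on `f` only through its trace `T` on the double sample, so a union
  -- bound over the polynomially many traces is enough.
  let c : Finset (ι ⊕ ι) → ι → ℝ := fun T i =>
    e (.inl i) * (if .inl i ∈ T then 1 else 0) - e (.inr i) * (if .inr i ∈ T then 1 else 0)
  have hc : ∀ T i, |c T i| ≤ 2 := by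
    intro T i
    have h : ∀ j, |e j * (if j ∈ T then 1 else 0)| ≤ 1 := by
      intro j
      split_ifs
      · simpa using he j
      · simp
    calc |c T i| ≤ _ := abs_sub _ _
      _ ≤ 1 + 1 := add_le_add (h _) (h _)
      _ = 2 := by norm_num
  have hsub : {σ : ι → Bool | ∃ f ∈ F, u < |∑ i, sgn (σ i) *
        (e (.inl i) * (if f (b (.inl i)) then 1 else 0) -
          e (.inr i) * (if f (b (.inr i)) then 1 else 0))|} ⊆
      ((traces F b).biUnion fun T =>
        Finset.univ.filter fun σ : ι → Bool => u < |∑ i, sgn (σ i) * c T i| : Finset _) := by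
    rintro σ ⟨f, hf, hσ⟩
    rw [Finset.mem_coe, Finset.mem_biUnion]
    refine ⟨_, mem_traces.2 ⟨f, hf, rfl⟩, ?_⟩
    simpa [c] using hσ
  have h1 : Set.ncard {σ : ι → Bool | ∃ f ∈ F, u < |∑ i, sgn (σ i) *
        (e (.inl i) * (if f (b (.inl i)) then 1 else 0) -
          e (.inr i) * (if f (b (.inr i)) then 1 else 0))|} ≤
      ∑ T ∈ traces F b,
        (Finset.univ.filter fun σ : ι → Bool => u < |∑ i, sgn (σ i) * c T i|).card := by
    refine le_trans (Set.ncard_le_ncard hsub (Finset.finite_toSet _)) ?_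
    rw [Set.ncard_coe_finset]
    exact Finset.card_biUnion_le
  have h2 : ((traces F b).card : ℝ) ≤ (2 * Fintype.card ι + 1) ^ d := by
    have := card_traces_le hd b
    rw [Fintype.card_sum, ← two_mul] at this
    exact_mod_cast this
  calc (Set.ncard _ : ℝ) ≤ ∑ T ∈ traces F b,
        ((Finset.univ.filter fun σ : ι → Bool => u < |∑ i, sgn (σ i) * c T i|).card : ℝ) := by
        exact_mod_cast h1
    _ ≤ ∑ _T ∈ traces F b,
        2 ^ Fintype.card ι * (2 * Real.exp (-(u ^ 2 / (8 * Fintype.card ι)))) :=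
      Finset.sum_le_sum fun T _ => card_signs_abs_sum_gt_le _ (hc T) hu
    _ = (traces F b).card * (2 ^ Fintype.card ι *
          (2 * Real.exp (-(u ^ 2 / (8 * Fintype.card ι))))) := by
      rw [Finset.sum_const, nsmul_eq_mul]
    _ ≤ (2 * Fintype.card ι + 1) ^ d * (2 ^ Fintype.card ι *
          (2 * Real.exp (-(u ^ 2 / (8 * Fintype.card ι))))) := by gcongr
    _ = _ := by ring

end Signs

section Convergence

/-! ### Uniform convergence -/

/-! ### Exchangeability of independent samples. -/

section Permutation

variable {α ι ι' : Type*} [MeasurableSpace α]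

theorem measurePreserving_comp_equiv [Fintype ι] [Fintype ι'] (μ : Measure α) [IsProbabilityMeasure μ] (e : ι' ≃ ι) :
    MeasurePreserving (fun w : ι → α => w ∘ e) (Measure.pi fun _ => μ)
      (Measure.pi fun _ => μ) := by
  have h := measurePreserving_piCongrLeft (fun _ : ι' => μ) e.symm
  convert h using 1
  ext w j
  have := MeasurableEquiv.piCongrLeft_apply_apply e.symm (β := fun _ => α) w (e j)
  simpa using this.symm

/-- Exchange the two copies of the index `i` wherever `σ i` is false. -/
def swapFun (σ : ι → Bool) : ι ⊕ ι → ι ⊕ ι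
  | .inl i => if σ i then .inl i else .inr i
  | .inr i => if σ i then .inr i else .inl i

theorem swapFun_involutive (σ : ι → Bool) : Function.Involutive (swapFun σ) := by
  rintro (i | i) <;> by_cases h : σ i <;> simp [swapFun, h]

/-- This turns measure-preserving exchanges of the two half-samples into random signs. -/
theorem swapFun_sub (σ : ι → Bool) (g : ι ⊕ ι → ℝ) (i : ι) :
    g (swapFun σ (.inl i)) - g (swapFun σ (.inr i)) =
      sgn (σ i) * (g (.inl i) - g (.inr i)) := by
  by_cases h : σ i <;> simp [swapFun, sgn, h]

theorem measurePreserving_comp_swapFun [Fintype ι] (μ : Measure α) [IsProbabilityMeasure μ]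
    (σ : ι → Bool) :
    MeasurePreserving (fun w : ι ⊕ ι → α => w ∘ swapFun σ) (Measure.pi fun _ => μ)
      (Measure.pi fun _ => μ) :=
  measurePreserving_comp_equiv μ (swapFun_involutive σ).toPerm

end Permutation

/-! ### Symmetrization and the Vapnik–Chervonenkis inequality. -/

variable {α A : Type*}

/-- The classifier `f`, evaluated at `a w` and weighted by `s w`. -/
def weighted (s : α → ℤ) (a : α → A) (f : A → Bool) (w : α) : ℝ :=
  s w * (if f (a w) then 1 else 0)

theorem abs_weighted_le {s : α → ℤ} (hs : ∀ w, |s w| ≤ 1) (a : α → A) (f : A → Bool) (w : α) :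
    |weighted s a f w| ≤ 1 := by
  have : |(s w : ℝ)| ≤ 1 := by exact_mod_cast hs w
  unfold weighted
  split_ifs
  · simpa using this
  · simp

/-- The double samples on whose halves the sums of some member of `F` differ by more than `u`. -/
def doubleDeviation (ι : Type*) [Fintype ι] (F : Set (A → Bool)) (s : α → ℤ) (a : α → A) (u : ℝ) :
    Set (ι ⊕ ι → α) :=
  {w | ∃ f ∈ F, u < |∑ i, (weighted s a f (w (.inl i)) - weighted s a f (w (.inr i)))|}

variable [MeasurableSpace α] [MeasurableSpace A] {μ : Measure α} [IsProbabilityMeasure μ]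
  {F : Set (A → Bool)} {s : α → ℤ} {a : α → A}

theorem measurable_weighted (hs : Measurable s) (ha : Measurable a) {f : A → Bool}
    (hf : Measurable f) : Measurable (weighted s a f) := by
  have h1 : Measurable fun w => (s w : ℝ) := measurable_from_top.comp hs
  refine h1.mul (Measurable.ite ?_ measurable_const measurable_const)
  exact (hf.comp ha) (MeasurableSet.singleton true)

/-- Suprema over a measurable class of weighted sums indexed by any finite type. -/
theorem IsMeasurableClass.aemeasurable_iSup_fintype {ν : Measure A} [IsProbabilityMeasure ν]
    (hF : IsMeasurableClass ν F) {κ : Type*} [Fintype κ] (e : κ → ℝ) :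
    AEMeasurable (fun b : κ → A => ⨆ f : F, |∑ j, e j * (if f.1 (b j) then 1 else 0)|)
      (Measure.pi fun _ => ν) := by
  let q := (Fintype.equivFin κ).symm
  have h1 := (hF.aemeasurable_iSup _ (e ∘ q)).comp_quasiMeasurePreserving
    (measurePreserving_comp_equiv ν q).quasiMeasurePreserving
  convert h1 using 1
  ext b
  simp only [Function.comp_apply]
  congr 1
  ext f
  congr 1
  exact (Equiv.sum_comp q fun j => e j * (if f.1 (b j) then (1 : ℝ) else 0)).symm

theorem nullMeasurableSet_exists_lt {ν : Measure A} [IsProbabilityMeasure ν]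
    (hF : IsMeasurableClass ν F) {κ : Type*} [Fintype κ] (e : κ → ℝ) {u : ℝ} (hu : 0 ≤ u) :
    NullMeasurableSet {b : κ → A | ∃ f ∈ F, u < |∑ j, e j * (if f (b j) then 1 else 0)|}
      (Measure.pi fun _ => ν) := by
  have h := (hF.aemeasurable_iSup_fintype e).nullMeasurableSet_preimage
    (measurableSet_Ioi (a := u))
  convert h using 1
  ext b
  simp only [Set.mem_ofPred_eq, Set.mem_preimage, Set.mem_Ioi]
  have hbdd : BddAbove (Set.range fun f : F => |∑ j, e j * (if f.1 (b j) then (1 : ℝ) else 0)|) := by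
    refine ⟨∑ j, |e j|, ?_⟩
    rintro _ ⟨f, rfl⟩
    refine (Finset.abs_sum_le_sum_abs _ _).trans (Finset.sum_le_sum fun j _ => ?_)
    split_ifs <;> simp
  constructor
  · rintro ⟨f, hf, h⟩
    exact h.trans_le (le_ciSup hbdd ⟨f, hf⟩)
  · intro h
    -- Over an empty class the real supremum is `0` by default; `0 ≤ u` excludes this case.
    rcases isEmpty_or_nonempty F with hE | hE
    · rw [Real.iSup_of_isEmpty] at h
      exact absurd h hu.not_gt
    · obtain ⟨f, hf⟩ := exists_lt_of_lt_ciSup h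
      exact ⟨f.1, f.2, hf⟩

/-- The hypothesis on `F` concerns constant weights, whereas here the weights depend on the sample.
As they are integers, the set splits into countably many pieces on which they are constant. -/
theorem nullMeasurableSet_doubleDeviation {N : ℕ} (hs : Measurable s) (ha : Measurable a)
    (hF : IsMeasurableClass (μ.map a) F) {u : ℝ} (hu : 0 ≤ u) :
    NullMeasurableSet (doubleDeviation (Fin N) F s a u) (Measure.pi fun _ => μ) := by
  have : IsProbabilityMeasure (μ.map a) := Measure.isProbabilityMeasure_map ha.aemeasurable
  let ε : Fin N ⊕ Fin N → ℝ := Sum.elim (fun _ => 1) (fun _ => -1)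
  have heq : doubleDeviation (Fin N) F s a u = ⋃ e : Fin N ⊕ Fin N → ℤ,
      ({w | ∀ j, s (w j) = e j} ∩ (fun w j => a (w j)) ⁻¹'
        {b | ∃ f ∈ F, u < |∑ j, (ε j * e j) * (if f (b j) then 1 else 0)|}) := by
    have key : ∀ (w : Fin N ⊕ Fin N → α) (f : A → Bool),
        ∑ i, (weighted s a f (w (.inl i)) - weighted s a f (w (.inr i))) =
          ∑ j, (ε j * s (w j)) * (if f (a (w j)) then 1 else 0) := by
      intro w f
      simp only [Fintype.sum_sum_type, weighted, ε, Finset.sum_sub_distrib, Sum.elim_inl,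
        Sum.elim_inr, neg_mul, one_mul, Finset.sum_neg_distrib]
      ring
    ext w
    simp only [doubleDeviation, Set.mem_ofPred_eq, Set.mem_iUnion, Set.mem_inter_iff,
      Set.mem_preimage]
    constructor
    · rintro ⟨f, hf, h⟩
      exact ⟨fun j => s (w j), fun _ => rfl, f, hf, by rwa [key] at h⟩
    · rintro ⟨e, he, f, hf, h⟩
      refine ⟨f, hf, ?_⟩
      rw [key]
      simpa only [he] using h
  rw [heq]
  refine NullMeasurableSet.iUnion fun e => NullMeasurableSet.inter ?_ ?_
  · have : MeasurableSet {w : Fin N ⊕ Fin N → α | ∀ j, s (w j) = e j} := by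
      rw [Set.ofPred_forall]
      exact MeasurableSet.iInter fun j =>
        (hs.comp (measurable_pi_apply j)) (MeasurableSet.singleton (e j))
    exact this.nullMeasurableSet
  · exact (nullMeasurableSet_exists_lt hF _ hu).preimage
      (measurePreserving_pi (fun _ => μ) (fun _ => μ.map a)
        fun _ => ⟨ha, rfl⟩).quasiMeasurePreserving

/-- Each swap preserves the product measure, so the measure of the set is the average over `σ` of
the measures of its swapped copies. After exchanging sum and integral, it remains to count, for a
fixed double sample, the sign patterns that give a large deviation. -/
theorem measure_doubleDeviation_le {N d : ℕ} (hs : Measurable s) (hs1 : ∀ w, |s w| ≤ 1)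
    (ha : Measurable a) (hF : IsMeasurableClass (μ.map a) F)
    (hd : ∀ B : Finset A, Shatters F B → B.card ≤ d) {u : ℝ} (hu : 0 ≤ u) :
    (Measure.pi fun _ => μ) (doubleDeviation (Fin N) F s a u) ≤
      ENNReal.ofReal ((2 * N + 1) ^ d * (2 * Real.exp (-(u ^ 2 / (8 * N))))) := by
  classical
  set ρ : Measure (Fin N ⊕ Fin N → α) := Measure.pi fun _ => μ with hρ
  set B := doubleDeviation (Fin N) F s a u with hB
  set C : ℝ := (2 * N + 1) ^ d * (2 * Real.exp (-(u ^ 2 / (8 * N)))) with hC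
  have hBm : NullMeasurableSet B ρ := nullMeasurableSet_doubleDeviation hs ha hF hu
  let T : (Fin N → Bool) → (Fin N ⊕ Fin N → α) → (Fin N ⊕ Fin N → α) := fun σ w => w ∘ swapFun σ
  have hT : ∀ σ, MeasurePreserving (T σ) ρ ρ := fun σ => measurePreserving_comp_swapFun μ σ
  have hTm : ∀ σ, NullMeasurableSet (T σ ⁻¹' B) ρ := fun σ =>
    hBm.preimage (hT σ).quasiMeasurePreserving
  have hpt : ∀ w, ∑ σ, (T σ ⁻¹' B).indicator (1 : (Fin N ⊕ Fin N → α) → ENNReal) w ≤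
      ENNReal.ofReal (2 ^ N * C) := by
    intro w
    have h1 : ∑ σ, (T σ ⁻¹' B).indicator (1 : (Fin N ⊕ Fin N → α) → ENNReal) w =
        ((Set.ncard {σ | T σ w ∈ B} : ℕ) : ENNReal) := by
      rw [Set.ncard_eq_toFinset_card']
      simp [Set.indicator_apply]
    rw [h1, ← ENNReal.ofReal_natCast]
    apply ENNReal.ofReal_le_ofReal
    have h2 := card_signs_exists_le hd (fun j => a (w j)) (fun j => (s (w j) : ℝ))
      (fun j => by exact_mod_cast hs1 (w j)) hu
    rw [Fintype.card_fin] at h2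
    refine le_trans (le_of_eq ?_) h2
    congr 2
    ext σ
    simp only [B, T, doubleDeviation, Set.mem_ofPred_eq, Function.comp_apply]
    have h3 : ∀ f i, weighted s a f (w (swapFun σ (.inl i))) -
        weighted s a f (w (swapFun σ (.inr i))) = _ := fun f i =>
      swapFun_sub σ (fun j => weighted s a f (w j)) i
    simp only [h3]
    rfl
  have hsum : (2 : ENNReal) ^ N * ρ B ≤ ENNReal.ofReal (2 ^ N * C) := by
    calc (2 : ENNReal) ^ N * ρ B = ∑ σ : Fin N → Bool, ρ (T σ ⁻¹' B) := by
          simp [(hT _).measure_preimage hBm]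
      _ = ∑ σ : Fin N → Bool, ∫⁻ w, (T σ ⁻¹' B).indicator 1 w ∂ρ := by
          simp only [lintegral_indicator_one₀ (hTm _)]
      _ = ∫⁻ w, ∑ σ : Fin N → Bool, (T σ ⁻¹' B).indicator 1 w ∂ρ :=
          (lintegral_finsetSum' _ fun σ _ => aemeasurable_one.indicator₀ (hTm σ)).symm
      _ ≤ ∫⁻ _w, ENNReal.ofReal (2 ^ N * C) ∂ρ := lintegral_mono hpt
      _ = ENNReal.ofReal (2 ^ N * C) := by simp
  rw [ENNReal.ofReal_mul (by positivity), ENNReal.ofReal_pow (by norm_num)] at hsum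
  simp only [ENNReal.ofReal_ofNat] at hsum
  exact (ENNReal.mul_le_mul_iff_right (by positivity) (by simp)).1 hsum

/-- Chebyshev's inequality for a mean of independent copies of a function with values
in `[-1, 1]`. -/
theorem half_le_measure_abs_sum_sub_le {N : ℕ} {g : α → ℝ} (hg : Measurable g)
    (hg1 : ∀ w, |g w| ≤ 1) {t : ℝ} (ht : 0 < t) (hN : 2 ≤ N * t ^ 2) :
    1 / 2 ≤ (Measure.pi fun _ : Fin N => μ)
      {w | |∑ i, g (w i) - N * ∫ x, g x ∂μ| < N * t} := by
  have hN0 : (0 : ℝ) < N := by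
    by_contra h
    have : (N : ℝ) = 0 := le_antisymm (not_lt.1 h) (Nat.cast_nonneg _)
    rw [this] at hN; norm_num at hN
  set ρ := Measure.pi fun _ : Fin N => μ with hρ
  have hmem : MemLp g 2 μ :=
    MemLp.of_bound hg.aestronglyMeasurable 1 (Filter.Eventually.of_forall fun w => by
      simpa using hg1 w)
  let G : (Fin N → α) → ℝ := ∑ i, fun w => g (w i)
  have hGapp : ∀ w, G w = ∑ i, g (w i) := fun w => by simp [G]
  have hmemi : ∀ i : Fin N, MemLp (fun w : Fin N → α => g (w i)) 2 ρ := fun i =>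
    hmem.comp_measurePreserving (measurePreserving_eval (fun _ : Fin N => μ) i)
  have hGmem : MemLp G 2 ρ := memLp_finsetSum' _ fun i _ => hmemi i
  have hint : ∫ w, G w ∂ρ = N * ∫ x, g x ∂μ := by
    simp only [hGapp]
    rw [integral_finsetSum _ fun i _ => (hmemi i).integrable (by norm_num)]
    simp [hρ, integral_comp_eval (μ := fun _ : Fin N => μ) hg.aestronglyMeasurable]
  have hvar : Var[G; ρ] ≤ N := by
    have h1 : Var[G; ρ] = ∑ _i : Fin N, Var[g; μ] := variance_sum_pi fun _ => hmem
    have h2 : Var[g; μ] ≤ ((1 - (-1)) / 2) ^ 2 :=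
      variance_le_sq_of_bounded (Filter.Eventually.of_forall fun w => abs_le.1 (hg1 w))
        hg.aemeasurable
    rw [h1, Finset.sum_const, Finset.card_univ, Fintype.card_fin, nsmul_eq_mul]
    nlinarith
  have hcheb := meas_ge_le_variance_div_sq hGmem (c := N * t) (by positivity)
  -- The variance of the sum is at most `N`, so Chebyshev gives `1 / (N t²) ≤ 1 / 2`.
  have hbad : ρ {w | N * t ≤ |G w - ∫ x, G x ∂ρ|} ≤ 1 / 2 := by
    refine hcheb.trans ?_
    have h3 : Var[G; ρ] / (N * t) ^ 2 ≤ 1 / 2 := by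
      rw [div_le_div_iff₀ (by positivity) (by norm_num)]
      nlinarith
    calc _ ≤ ENNReal.ofReal (1 / 2) := ENNReal.ofReal_le_ofReal h3
      _ = 1 / 2 := by rw [ENNReal.ofReal_div_of_pos (by norm_num)]; simp
  have hGm : Measurable G := by
    rw [show G = fun w => ∑ i, g (w i) from funext hGapp]
    fun_prop
  have hset : {w : Fin N → α | |∑ i, g (w i) - N * ∫ x, g x ∂μ| < N * t} =
      {w | N * t ≤ |G w - ∫ x, G x ∂ρ|}ᶜ := by
    rw [hint]
    ext w
    simp [hGapp]
  rw [hset, prob_compl_eq_one_sub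
    (measurableSet_le measurable_const ((hGm.sub_const _).abs))]
  calc (1 / 2 : ENNReal) = 1 - 1 / 2 := by simp
    _ ≤ _ := tsub_le_tsub_left hbad 1

/-- The **Vapnik–Chervonenkis inequality** for a measurable class of bounded VC dimension with
weights in `{-1, 0, 1}`. The measure on the left is an outer measure. -/
theorem measure_exists_deviation_le {N d : ℕ} (hs : Measurable s) (hs1 : ∀ w, |s w| ≤ 1)
    (ha : Measurable a) (hF : IsMeasurableClass (μ.map a) F)
    (hd : ∀ B : Finset A, Shatters F B → B.card ≤ d) {t : ℝ} (ht : 0 < t)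
    (hN : 2 ≤ N * t ^ 2) :
    (Measure.pi fun _ : Fin N => μ)
      {S | ∃ f ∈ F, 2 * (N * t) < |∑ i, weighted s a f (S i) - N * ∫ w, weighted s a f w ∂μ|} ≤
      ENNReal.ofReal (4 * (2 * N + 1) ^ d * Real.exp (-(N * t ^ 2 / 8))) := by
  have hN0 : (N : ℝ) ≠ 0 := by
    intro h
    rw [h] at hN; norm_num at hN
  set ρ := Measure.pi fun _ : Fin N => μ with hρ
  set ρ₂ : Measure (Fin N ⊕ Fin N → α) := Measure.pi fun _ => μ with hρ₂
  set B := doubleDeviation (Fin N) F s a (N * t) with hB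
  let φ := MeasurableEquiv.sumPiEquivProdPi (fun _ : Fin N ⊕ Fin N => α)
  have hφ : MeasurePreserving φ.symm (ρ.prod ρ) ρ₂ :=
    measurePreserving_sumPiEquivProdPi_symm fun _ : Fin N ⊕ Fin N => μ
  -- `B` is only null measurable; its measurable hull has the same measure and measurable sections.
  let B' := φ.symm ⁻¹' toMeasurable ρ₂ B
  have hB'm : MeasurableSet B' := φ.symm.measurable (measurableSet_toMeasurable _ _)
  have hB' : (ρ.prod ρ) B' = ρ₂ B := by
    rw [hφ.measure_preimage (measurableSet_toMeasurable _ _).nullMeasurableSet,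
      measure_toMeasurable]
  let h : (Fin N → α) → ENNReal := fun S => ρ (Prod.mk S ⁻¹' B')
  have hm : Measurable h := measurable_measure_prodMk_left hB'm
  -- If `f` deviates by more than `2Nt` on `S`, then with probability at least `1/2` a ghost sample
  -- is within `Nt` of the mean for this same `f`, so the halves differ by more than `Nt`. Markov's
  -- inequality for `h` then costs a factor `2`.
  have hsub : {S : Fin N → α | ∃ f ∈ F, 2 * (N * t) <
      |∑ i, weighted s a f (S i) - N * ∫ w, weighted s a f w ∂μ|} ⊆ {S | 1 / 2 ≤ h S} := by
    rintro S ⟨f, hf, hS⟩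
    refine (half_le_measure_abs_sum_sub_le (μ := μ)
      (measurable_weighted hs ha (hF.measurable f hf)) (abs_weighted_le hs1 a f) ht hN).trans
      (measure_mono fun S' hS' => ?_)
    refine subset_toMeasurable ρ₂ B ⟨f, hf, ?_⟩
    change N * t < |∑ i, (weighted s a f (S i) - weighted s a f (S' i))|
    rw [Set.mem_ofPred_eq] at hS'
    rw [Finset.sum_sub_distrib]
    have := abs_sub_le (∑ i, weighted s a f (S i)) (∑ i, weighted s a f (S' i))
      (N * ∫ w, weighted s a f w ∂μ)
    linarith
  have hmarkov := mul_meas_ge_le_lintegral (μ := ρ) hm (1 / 2)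
  rw [← Measure.prod_apply hB'm, hB'] at hmarkov
  have hdd := measure_doubleDeviation_le (μ := μ) (N := N) hs hs1 ha hF hd
    (u := N * t) (by positivity)
  have hexp : (N * t) ^ 2 / (8 * N) = N * t ^ 2 / 8 := by field_simp
  rw [hexp] at hdd
  calc _ ≤ ρ {S | 1 / 2 ≤ h S} := measure_mono hsub
    _ = 2 * (1 / 2 * ρ {S | 1 / 2 ≤ h S}) := by
      rw [← mul_assoc, one_div, ENNReal.mul_inv_cancel (by simp) (by simp), one_mul]
    _ ≤ 2 * ENNReal.ofReal ((2 * N + 1) ^ d * (2 * Real.exp (-(N * t ^ 2 / 8)))) := by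
      gcongr
      exact hmarkov.trans hdd
    _ = _ := by
      rw [show (2 : ENNReal) = ENNReal.ofReal 2 by simp, ← ENNReal.ofReal_mul (by norm_num)]
      congr 1
      ring

end Convergence

variable {X : Type*} [MeasurableSpace X] {m : ℕ} {p : Fin m → ℕ}

/-! ### Events and empirical distributions -/

theorem measurable_inputOf : Measurable (inputOf : Data X p → X × Attr p) :=
  measurable_fst.prodMk measurable_snd.snd

theorem measurableSet_event {E : Set (Bool × Data X p)} (hE : MeasurableSet E)
    {f : Classifier X p} (hf : Measurable f) : MeasurableSet (event E f) :=
  ((hf.comp measurable_inputOf).prodMk measurable_id) hE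

instance isFiniteMeasure_empirical {N : ℕ} (S : Fin N → Data X p) :
    IsFiniteMeasure (empirical S) := by
  rcases Nat.eq_zero_or_pos N with rfl | hN
  -- For `N = 0` the scalar is `⊤`, but it multiplies the zero measure.
  · simp only [empirical, Finset.univ_eq_empty, Finset.sum_empty, smul_zero]
    infer_instance
  · have : (N : ENNReal)⁻¹ ≠ ⊤ := by simp [hN.ne']
    exact Measure.smul_finite _ this

theorem empirical_real {N : ℕ} (S : Fin N → Data X p) {B : Set (Data X p)}
    (hB : MeasurableSet B) :
    (empirical S).real B = (∑ i, B.indicator (1 : Data X p → ℝ) (S i)) / N := by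
  have h : ∀ i, (Measure.dirac (S i) B).toReal = B.indicator (1 : Data X p → ℝ) (S i) := by
    intro i
    rw [Measure.dirac_apply' _ hB]
    by_cases h : S i ∈ B <;> simp [h]
  rw [measureReal_def, empirical, Measure.smul_apply, Measure.finsetSum_apply, smul_eq_mul,
    ENNReal.toReal_mul, ENNReal.toReal_sum (fun i _ => measure_ne_top _ _)]
  simp only [h, ENNReal.toReal_inv, ENNReal.toReal_natCast]
  rw [div_eq_inv_mul]

/-- Changing the protected attributes of an `η` fraction of the samples moves every empirical
probability by at most `η`. -/
theorem IsHammingPerturbation.abs_empirical_sub_le {N : ℕ} (hN : 0 < N) {η : ℝ}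
    {S S' : Fin N → Data X p} (h : IsHammingPerturbation η S S') {B : Set (Data X p)}
    (hB : MeasurableSet B) : |(empirical S').real B - (empirical S).real B| ≤ η := by
  have hN' : (0 : ℝ) < N := by exact_mod_cast hN
  rw [empirical_real S hB, empirical_real S' hB, ← sub_div, abs_div, abs_of_pos hN',
    div_le_iff₀ hN', ← Finset.sum_sub_distrib]
  refine le_trans ?_ h.2
  rw [Finset.card_filter]
  push_cast
  refine (Finset.abs_sum_le_sum_abs _ _).trans (Finset.sum_le_sum fun i _ => ?_)
  by_cases hi : (S' i).2.2 = (S i).2.2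
  · have : S' i = S i := Prod.ext (h.1 i).1 (Prod.ext (h.1 i).2 hi)
    simp [this]
  · rw [if_pos hi]
    by_cases h1 : S' i ∈ B <;> by_cases h2 : S i ∈ B <;> simp [h1, h2]

/-! ### Uniform convergence for events determined by a classifier. -/

section Deviation

variable {D : Measure (Data X p)} [IsProbabilityMeasure D] {F : Set (Classifier X p)} {d : ℕ}

theorem integrable_weighted {α A : Type*} [MeasurableSpace α] [MeasurableSpace A] {μ : Measure α}
    [IsProbabilityMeasure μ] {s : α → ℤ} {a : α → A} (hs : Measurable s)
    (hs1 : ∀ w, |s w| ≤ 1) (ha : Measurable a) {f : A → Bool} (hf : Measurable f) :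
    Integrable (weighted s a f) μ :=
  Integrable.of_bound (measurable_weighted hs ha hf).aestronglyMeasurable 1
    (Filter.Eventually.of_forall fun w => by simpa using abs_weighted_le hs1 a f w)

/-- Lets the VC inequality also serve for the one function that does not depend on the classifier,
as a class of dimension `0`. -/
theorem isMeasurableClass_singleton {A : Type*} [MeasurableSpace A] (μ : Measure A)
    {f : A → Bool} (hf : Measurable f) : IsMeasurableClass μ {f} := by
  refine ⟨fun g hg => hg ▸ hf, fun n e => Measurable.aemeasurable ?_⟩
  simp only [ciSup_unique, Set.default_coe_singleton]
  refine (Finset.measurable_sum _ fun i _ => measurable_const.mul ?_).abs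
  exact Measurable.ite ((hf.comp (measurable_pi_apply i)) (MeasurableSet.singleton true))
    measurable_const measurable_const

theorem card_le_zero_of_shatters_singleton {A : Type*} {f : A → Bool} {B : Finset A}
    (h : Shatters {f} B) : B.card ≤ 0 := by
  by_contra hB
  obtain ⟨a, ha⟩ := Finset.card_pos.1 (not_le.1 hB)
  obtain ⟨g, hg, h1⟩ := h ∅ (Finset.empty_subset _)
  obtain ⟨g', hg', h2⟩ := h B subset_rfl
  rw [Set.mem_singleton_iff] at hg hg'
  subst hg hg'
  exact absurd ((h1 a ha).1 ((h2 a ha).2 ha)) (Finset.notMem_empty a)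

/-- Uniform convergence of the empirical probabilities of the events given by `E` over
the class `F`. -/
theorem measure_event_deviation_le {N : ℕ} (hF : IsMeasurableClass (D.map inputOf) F)
    (hd : ∀ B, Shatters F B → B.card ≤ d) {E : Set (Bool × Data X p)} (hE : MeasurableSet E)
    {t : ℝ} (ht : 0 < t) (hN : 2 ≤ N * t ^ 2) :
    (Measure.pi fun _ : Fin N => D)
      {S | ∃ f ∈ F, 4 * t < |(empirical S).real (event E f) - D.real (event E f)|} ≤
      ENNReal.ofReal (8 * (2 * N + 1) ^ d * Real.exp (-(N * t ^ 2 / 8))) := by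
  classical
  have hN0 : (0 : ℝ) < N := by
    by_contra h
    have : (N : ℝ) = 0 := le_antisymm (not_lt.1 h) (Nat.cast_nonneg _)
    rw [this] at hN; norm_num at hN
  let ind : Bool → Data X p → ℤ := fun b w => if (b, w) ∈ E then 1 else 0
  have hind : ∀ b, Measurable (ind b) := fun b =>
    Measurable.ite (measurable_prodMk_left hE) measurable_const measurable_const
  -- The indicator of the event is `ind false w + s w · f(w)`. The first term is a single fixed
  -- function and the second a weighted member of `F`. Each may deviate by `2t`, whence `4t`.
  let s : Data X p → ℤ := fun w => ind true w - ind false w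
  have hs : Measurable s := (hind true).sub (hind false)
  have hs1 : ∀ w, |s w| ≤ 1 := by
    intro w
    simp only [s, ind]
    split_ifs <;> simp
  have hind1 : ∀ w, |ind false w| ≤ 1 := by
    intro w
    simp only [ind]
    split_ifs <;> simp
  let a₀ : Data X p → Unit := fun _ => ()
  let f₀ : Unit → Bool := fun _ => true
  have ha₀ : Measurable a₀ := measurable_const
  have hf₀ : Measurable f₀ := measurable_const
  let g := weighted (ind false) a₀ f₀
  have hsplit : ∀ (f : Classifier X p) (w : Data X p),
      (event E f).indicator (1 : Data X p → ℝ) w = g w + weighted s inputOf f w := by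
    intro f w
    have h1 : w ∈ event E f ↔ (f (inputOf w), w) ∈ E := Iff.rfl
    by_cases hb : f (inputOf w) = true
    · simp [Set.indicator_apply, h1, g, weighted, f₀, s, ind, hb]
    · simp [Set.indicator_apply, h1, g, weighted, f₀, ind, hb]
  let U : Set (Fin N → Data X p) := {S | ∃ f ∈ F, 2 * (N * t) <
    |∑ i, weighted s inputOf f (S i) - N * ∫ w, weighted s inputOf f w ∂D|}
  let V : Set (Fin N → Data X p) := {S | ∃ f ∈ ({f₀} : Set (Unit → Bool)), 2 * (N * t) <
    |∑ i, weighted (ind false) a₀ f (S i) - N * ∫ w, weighted (ind false) a₀ f w ∂D|}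
  have hU : (Measure.pi fun _ : Fin N => D) U ≤ _ :=
    measure_exists_deviation_le hs hs1 measurable_inputOf hF hd ht hN
  have hV : (Measure.pi fun _ : Fin N => D) V ≤ _ :=
    measure_exists_deviation_le (hind false) hind1 ha₀ (isMeasurableClass_singleton _ hf₀)
      (fun B hB => card_le_zero_of_shatters_singleton hB) ht hN
  have hsub : {S : Fin N → Data X p | ∃ f ∈ F,
      4 * t < |(empirical S).real (event E f) - D.real (event E f)|} ⊆ U ∪ V := by
    rintro S ⟨f, hf, h⟩
    by_contra hUV
    rw [Set.mem_union, not_or] at hUV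
    have h1 : |∑ i, weighted s inputOf f (S i) - N * ∫ w, weighted s inputOf f w ∂D| ≤
        2 * (N * t) := not_lt.1 fun h => hUV.1 ⟨f, hf, h⟩
    have h2 : |∑ i, g (S i) - N * ∫ w, g w ∂D| ≤ 2 * (N * t) :=
      not_lt.1 fun h => hUV.2 ⟨f₀, rfl, h⟩
    have hfm := hF.measurable f hf
    have hEm := measurableSet_event hE hfm
    have hreal : D.real (event E f) = ∫ w, g w ∂D + ∫ w, weighted s inputOf f w ∂D := by
      rw [← integral_add (integrable_weighted (hind false) hind1 ha₀ hf₀)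
        (integrable_weighted hs hs1 measurable_inputOf hfm), ← integral_indicator_one hEm]
      exact integral_congr_ae (Filter.Eventually.of_forall fun w => hsplit f w)
    rw [empirical_real S hEm, hreal] at h
    simp only [hsplit, Finset.sum_add_distrib] at h
    have h3 : (∑ i, g (S i) + ∑ i, weighted s inputOf f (S i)) / N -
        (∫ w, g w ∂D + ∫ w, weighted s inputOf f w ∂D) =
        ((∑ i, g (S i) - N * ∫ w, g w ∂D) +
          (∑ i, weighted s inputOf f (S i) - N * ∫ w, weighted s inputOf f w ∂D)) / N := by
      field_simp
      ring
    rw [h3, abs_div, abs_of_pos hN0, lt_div_iff₀ hN0] at h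
    have := abs_add_le (∑ i, g (S i) - N * ∫ w, g w ∂D)
      (∑ i, weighted s inputOf f (S i) - N * ∫ w, weighted s inputOf f w ∂D)
    linarith
  refine (measure_mono hsub).trans ((measure_union_le _ _).trans ((add_le_add hU hV).trans ?_))
  rw [← ENNReal.ofReal_add (by positivity) (by positivity)]
  apply ENNReal.ofReal_le_ofReal
  have h1 : (1 : ℝ) ≤ (2 * N + 1) ^ d := one_le_pow₀ (by linarith)
  have h2 := Real.exp_pos (-(N * t ^ 2 / 8))
  nlinarith

theorem measure_family_deviation_le {N : ℕ} (hF : IsMeasurableClass (D.map inputOf) F)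
    (hd : ∀ B, Shatters F B → B.card ≤ d) {κ : Type*} [Fintype κ]
    {E : κ → Set (Bool × Data X p)} (hE : ∀ k, MeasurableSet (E k))
    {t : ℝ} (ht : 0 < t) (hN : 2 ≤ N * t ^ 2) :
    (Measure.pi fun _ : Fin N => D)
      {S | ∃ k, ∃ f ∈ F, 4 * t < |(empirical S).real (event (E k) f) - D.real (event (E k) f)|} ≤
      ENNReal.ofReal (Fintype.card κ *
        (8 * (2 * N + 1) ^ d * Real.exp (-(N * t ^ 2 / 8)))) := by
  rw [Set.ofPred_exists]
  refine (measure_iUnion_fintype_le _ _).trans ?_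
  refine (Finset.sum_le_sum fun k _ => measure_event_deviation_le hF hd (hE k) ht hN).trans ?_
  rw [Finset.sum_const, nsmul_eq_mul, ENNReal.ofReal_mul (Nat.cast_nonneg _),
    ENNReal.ofReal_natCast, Finset.card_univ]

end Deviation

/-! ### Stability of the fairness metrics -/

/-- With `x = κ / l`, the bounds `l ≤ J ≤ C` give `κ ≤ xJ ≤ xC`, so the additive error `κ` is a
relative error `x` in both numerator and denominator. -/
theorem ratio_stable {J C J' C' κ l : ℝ} (hκ : 0 ≤ κ) (hκl : κ < l) (hJ : l ≤ J) (hJC : J ≤ C)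
    (hJ' : |J' - J| ≤ κ) (hC' : |C' - C| ≤ κ) :
    J / C * ((1 - κ / l) / (1 + κ / l)) ≤ J' / C' ∧
      J' / C' ≤ J / C * ((1 - κ / l) / (1 + κ / l))⁻¹ := by
  have hl : 0 < l := hκ.trans_lt hκl
  obtain ⟨x, hx⟩ : ∃ x, x = κ / l := ⟨_, rfl⟩
  have hκx : κ = x * l := by rw [hx]; field_simp
  have hx0 : 0 ≤ x := by rw [hx]; positivity
  have hx1 : x < 1 := by rw [hx, div_lt_one hl]; exact hκl
  have hκJ : κ ≤ x * J := by rw [hκx]; gcongr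
  have hκC : κ ≤ x * C := hκJ.trans (by gcongr)
  have hJ0 : 0 < J := hl.trans_le hJ
  have hC0 : 0 < C := hJ0.trans_le hJC
  rw [abs_le] at hJ' hC'
  have h1 : J * (1 - x) ≤ J' := by linarith
  have h2 : J' ≤ J * (1 + x) := by linarith
  have h3 : C * (1 - x) ≤ C' := by linarith
  have h4 : C' ≤ C * (1 + x) := by linarith
  have hx1' : 0 < 1 - x := by linarith
  have h5 : 0 < C * (1 - x) := mul_pos hC0 hx1'
  have h6 : 0 ≤ J * (1 - x) := (mul_pos hJ0 hx1').le
  rw [← hx]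
  constructor
  · rw [div_mul_div_comm]
    exact div_le_div₀ (h6.trans h1) h1 (h5.trans_le h3) h4
  · rw [inv_div, div_mul_div_comm]
    exact div_le_div₀ (by positivity) h2 h5 h3

/-- The minimum loses at most a factor `c` and the maximum gains at most `c⁻¹`, which explains the
square. -/
theorem iInf_div_iSup_stable {n : ℕ} (hn : 0 < n) {q q' : Fin n → ℝ} {c : ℝ} (hc : 0 < c)
    (hq : ∀ l, 0 < q l) (h1 : ∀ l, q l * c ≤ q' l) (h2 : ∀ l, q' l ≤ q l * c⁻¹) :
    (⨅ l, q l) / (⨆ l, q l) * c ^ 2 ≤ (⨅ l, q' l) / (⨆ l, q' l) := by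
  have : Nonempty (Fin n) := ⟨⟨0, hn⟩⟩
  let l₀ : Fin n := ⟨0, hn⟩
  have hInf : (⨅ l, q l) * c ≤ ⨅ l, q' l :=
    le_ciInf fun l => (mul_le_mul_of_nonneg_right
      (ciInf_le (Set.finite_range q).bddBelow l) hc.le).trans (h1 l)
  have hSup : (⨆ l, q' l) ≤ (⨆ l, q l) * c⁻¹ :=
    ciSup_le fun l => (h2 l).trans (mul_le_mul_of_nonneg_right
      (le_ciSup (Set.finite_range q).bddAbove l) (inv_pos.2 hc).le)
  have hInf0 : 0 ≤ ⨅ l, q l := le_ciInf fun l => (hq l).le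
  have hq'0 : 0 < ⨆ l, q' l := ((mul_pos (hq l₀) hc).trans_le (h1 l₀)).trans_le
    (le_ciSup (Set.finite_range q').bddAbove l₀)
  calc (⨅ l, q l) / (⨆ l, q l) * c ^ 2 = ((⨅ l, q l) * c) / ((⨆ l, q l) * c⁻¹) := by
        field_simp
    _ ≤ _ := div_le_div₀ ((mul_nonneg hInf0 hc.le).trans hInf) hInf hq'0 hSup

theorem fairness_stable {D D' : Measure (Data X p)} [IsFiniteMeasure D] {M : PerfMetric X p}
    {r : Fin m} (hp : 0 < p r) {f : Classifier X p} {κ lam : ℝ} (hκ : 0 ≤ κ) (hκl : κ < lam)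
    (hlam : ∀ l, lam ≤ jointProb D M r f l)
    (hJ : ∀ l, |jointProb D' M r f l - jointProb D M r f l| ≤ κ)
    (hC : ∀ l, |D'.real (event M.cond f ∩ group X p r l) -
      D.real (event M.cond f ∩ group X p r l)| ≤ κ) :
    fairness D M r f * ((1 - κ / lam) / (1 + κ / lam)) ^ 2 ≤ fairness D' M r f := by
  have hl : 0 < lam := hκ.trans_lt hκl
  have hle : ∀ l, jointProb D M r f l ≤ D.real (event M.cond f ∩ group X p r l) := fun l =>
    measureReal_mono (by rw [Set.inter_assoc]; exact Set.inter_subset_right)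
  have hx : κ / lam < 1 := (div_lt_one hl).2 hκl
  have hx0 : 0 ≤ κ / lam := by positivity
  have hstab := fun l => ratio_stable hκ hκl (hlam l) (hle l) (hJ l) (hC l)
  exact iInf_div_iSup_stable hp (div_pos (by linarith) (by linarith))
    (fun l => div_pos (hl.trans_le (hlam l)) ((hl.trans_le (hlam l)).trans_le (hle l)))
    (fun l => (hstab l).1) (fun l => (hstab l).2)

/-! ### The error-tolerant program on a representative sample -/

/-- Pairs of a prediction and a data point at which the prediction is wrong. -/
def errEvent (X : Type*) {m : ℕ} (p : Fin m → ℕ) : Set (Bool × Data X p) := {v | v.1 ≠ v.2.2.1}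

/-- `group`, as a set of pairs of a prediction and a data point. -/
def groupEvent (X : Type*) {m : ℕ} (p : Fin m → ℕ) (r : Fin m) (l : Fin (p r)) :
    Set (Bool × Data X p) := {v | v.2.2.2 r = l}

theorem measurableSet_errEvent : MeasurableSet (errEvent X p) :=
  (measurableSet_eq_fun measurable_fst measurable_snd.snd.fst).compl

theorem measurableSet_groupEvent (r : Fin m) (l : Fin (p r)) :
    MeasurableSet (groupEvent X p r l) :=
  ((measurable_pi_apply r).comp (measurable_snd.snd.snd : Measurable fun v : Bool × Data X p =>
    v.2.2.2)) (MeasurableSet.singleton l)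

/-- The events whose probabilities occur in the error-tolerant program. -/
def programEvent (M : Fin m → PerfMetric X p) :
    Option (Bool × Σ r : Fin m, Fin (p r)) → Set (Bool × Data X p)
  | none => errEvent X p
  | some (true, ⟨r, l⟩) => (M r).main ∩ (M r).cond ∩ groupEvent X p r l
  | some (false, ⟨r, l⟩) => (M r).cond ∩ groupEvent X p r l

theorem measurableSet_programEvent (M : Fin m → PerfMetric X p) :
    ∀ k, MeasurableSet (programEvent M k)
  | none => measurableSet_errEvent
  | some (true, ⟨r, l⟩) => ((M r).measurableSet_main.inter (M r).measurableSet_cond).inter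
      (measurableSet_groupEvent r l)
  | some (false, ⟨r, l⟩) => (M r).measurableSet_cond.inter (measurableSet_groupEvent r l)

/-- The empirical error is a natural number divided by `N`, so well-ordering gives a minimizer even
when the class is infinite. -/
theorem exists_isErrMinimizer_empirical {N : ℕ} (S : Fin N → Data X p)
    {C : Set (Classifier X p)} (hC : C.Nonempty) (hm : ∀ f ∈ C, Measurable f) :
    ∃ f, IsErrMinimizer (empirical S) C f := by
  classical
  let k : Classifier X p → ℕ := fun f =>
    (Finset.univ.filter fun i => S i ∈ event (errEvent X p) f).card
  have hk : ∀ f ∈ C, err (empirical S) f = (k f : ℝ) / N := by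
    intro f hf
    refine (empirical_real S (measurableSet_event measurableSet_errEvent (hm f hf))).trans ?_
    simp [k, Set.indicator_apply]
  have hmem := Function.argminOn_mem k C hC
  refine ⟨_, hmem, fun g hg => ?_⟩
  rw [Set.mem_ofPred_eq, hk _ hmem, hk g hg]
  have : k (Function.argminOn k C hC) ≤ k g := Function.argminOn_le k C hg
  gcongr

/-- Since `(1 - x) / (1 + x) ≥ 1 - 2x`, the product is at least `τ(1 - 2x)⁴`, and Bernoulli's
inequality applies. -/
theorem sub_le_mul_sq_mul_sq {τ x : ℝ} (hτ : 0 ≤ τ) (hx0 : 0 ≤ x) (hx : x < 1 / 2) :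
    τ - 8 * τ * x ≤ τ * ((1 - x) / (1 + x)) ^ 2 * (1 - 2 * x) ^ 2 := by
  have h1 : 1 - 2 * x ≤ (1 - x) / (1 + x) := by
    rw [le_div_iff₀ (by linarith)]
    nlinarith
  have h2 : 0 ≤ 1 - 2 * x := by linarith
  have h3 : (1 - 2 * x) ^ 2 ≤ ((1 - x) / (1 + x)) ^ 2 := pow_le_pow_left₀ h2 h1 2
  have h4 : 1 - 8 * x ≤ (1 - 2 * x) ^ 2 * (1 - 2 * x) ^ 2 := by
    have := one_add_mul_le_pow (a := -(2 * x)) (by linarith) 4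
    push_cast at this
    calc 1 - 8 * x = 1 + 4 * -(2 * x) := by ring
      _ ≤ _ := this
      _ = _ := by ring
  calc τ - 8 * τ * x = τ * (1 - 8 * x) := by ring
    _ ≤ τ * ((1 - 2 * x) ^ 2 * (1 - 2 * x) ^ 2) := by gcongr
    _ ≤ τ * (((1 - x) / (1 + x)) ^ 2 * (1 - 2 * x) ^ 2) := by gcongr
    _ = _ := by ring

/-- If the perturbed sample represents every event of the program up to `η + Δ`, then
the error-tolerant program is solvable, and its solutions are accurate and fair. -/
theorem errTolerant_of_representative {D : Measure (Data X p)} [IsProbabilityMeasure D]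
    {M : Fin m → PerfMetric X p} {F : Set (Classifier X p)} {τ lam η ε ν Δ : ℝ}
    {fstar : Classifier X p} (hp : ∀ r, 0 < p r) (hF : ∀ f ∈ F, Measurable f)
    (hτ : 0 < τ) (hτ1 : τ ≤ 1) (hstar : IsErrMinimizer D (fairSet D M F τ) fstar)
    (hstarJ : ∀ r l, lam ≤ jointProb D (M r) r fstar l)
    (hη : 0 < η) (hηlam : η < lam / 2) (hΔ : 0 < Δ) (hΔε : 96 * Δ ≤ ε - 2 * η)
    (hΔν : 96 * Δ ≤ (lam - 2 * η) * (ν - 8 * η * τ / (lam - 2 * η)))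
    (hΔlam : 96 * Δ ≤ lam - 2 * η) {N : ℕ} {S : Fin N → Data X p}
    (hclose : ∀ k, ∀ f ∈ F, |(empirical S).real (event (programEvent M k) f) -
      D.real (event (programEvent M k) f)| ≤ η + Δ) :
    (∃ f, IsErrTolerantSolution S M F τ η lam Δ f) ∧
      ∀ f, IsErrTolerantSolution S M F τ η lam Δ f →
        err D f - err D fstar ≤ ε ∧ ∀ r, τ - ν ≤ fairness D (M r) r f := by
  have herr : ∀ f ∈ F, |err (empirical S) f - err D f| ≤ η + Δ := hclose none
  have hJ : ∀ f ∈ F, ∀ r l, |jointProb (empirical S) (M r) r f l - jointProb D (M r) r f l| ≤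
      η + Δ := fun f hf r l => hclose (some (true, ⟨r, l⟩)) f hf
  have hC : ∀ f ∈ F, ∀ r l, |(empirical S).real (event (M r).cond f ∩ group X p r l) -
      D.real (event (M r).cond f ∩ group X p r l)| ≤ η + Δ :=
    fun f hf r l => hclose (some (false, ⟨r, l⟩)) f hf
  obtain ⟨κ, hκ⟩ : ∃ κ, κ = η + Δ := ⟨_, rfl⟩
  have hκ0 : 0 ≤ κ := by linarith
  have hκlam : κ < lam / 2 := by linarith
  have hlam : 0 < lam := by linarith
  have hfF : fstar ∈ F := hstar.1.1
  have hfeas : fstar ∈ errTolerantSet S M F τ η lam Δ := by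
    refine ⟨hfF, fun r => ?_, fun r l => ?_⟩
    · rw [← hκ]
      refine le_trans ?_ (fairness_stable (D := D) (hp r) hκ0 (by linarith) (hstarJ r)
        (hκ ▸ hJ fstar hfF r) (hκ ▸ hC fstar hfF r))
      exact mul_le_mul_of_nonneg_right (hstar.1.2 r) (sq_nonneg _)
    · have := (abs_le.1 (hJ fstar hfF r l)).1
      linarith [hstarJ r l]
  refine ⟨exists_isErrMinimizer_empirical S ⟨_, hfeas⟩ fun f hf => hF f hf.1, ?_⟩
  rintro f ⟨⟨hf, hfair, hjoint⟩, hmin⟩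
  constructor
  · have h1 : err (empirical S) f ≤ err (empirical S) fstar := hmin hfeas
    have h2 := (abs_le.1 (herr f hf)).1
    have h3 := (abs_le.1 (herr fstar hfF)).2
    linarith
  · intro r
    -- The roles are reversed: feasibility bounds the empirical joint probabilities of `f` below by
    -- `lam - κ`, and no such bound under `D` is known beforehand.
    have h1 := fairness_stable (D := empirical S) (D' := D) (M := M r) (f := f) (hp r) hκ0
      (lam := lam - κ) (by linarith) (fun l => by linarith [hjoint r l])
      (fun l => by rw [abs_sub_comm]; exact hκ ▸ hJ f hf r l)
      (fun l => by rw [abs_sub_comm]; exact hκ ▸ hC f hf r l)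
    have hlκ : lam - κ ≠ 0 := by linarith
    have hx' : (1 - κ / (lam - κ)) / (1 + κ / (lam - κ)) = 1 - 2 * (κ / lam) := by
      have : 1 + κ / (lam - κ) ≠ 0 := by
        have : 0 ≤ κ / (lam - κ) := div_nonneg hκ0 (by linarith)
        linarith
      rw [div_eq_iff this]
      field_simp
      ring
    rw [hx'] at h1
    have h2 := hfair r
    rw [← hκ] at h2
    have h3 := sub_le_mul_sq_mul_sq hτ.le (x := κ / lam) (by positivity)
      (by rw [div_lt_div_iff₀ hlam (by norm_num)]; linarith)
    have h4 : 8 * τ * (κ / lam) ≤ ν := by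
      have hpos : 0 < lam - 2 * η := by linarith
      have h5 : (lam - 2 * η) * (ν - 8 * η * τ / (lam - 2 * η)) =
          (lam - 2 * η) * ν - 8 * η * τ := by field_simp
      rw [h5] at hΔν
      have hτΔ : τ * Δ ≤ Δ := by nlinarith
      -- Indeed `8τκ ≤ 8ητ + 8Δ`, and the slack `96Δ` in `hΔν` covers the last term.
      have h6 : 8 * τ * κ ≤ (lam - 2 * η) * ν := by rw [hκ]; nlinarith
      have hν : 0 ≤ ν := by
        by_contra h
        have : 0 ≤ 8 * τ * κ := by positivity
        nlinarith
      rw [← mul_div_assoc, div_le_iff₀ hlam]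
      nlinarith
    calc τ - ν ≤ τ - 8 * τ * (κ / lam) := by linarith
      _ ≤ _ := h3
      _ ≤ fairness (empirical S) (M r) r f * (1 - 2 * (κ / lam)) ^ 2 :=
        mul_le_mul_of_nonneg_right h2 (sq_nonneg _)
      _ ≤ _ := h1

/-! ### Sample size -/

/-- The polynomial bound on the sample size. -/
def samplePoly : MvPolynomial (Fin 3) ℝ :=
  256 * MvPolynomial.X 1 ^ 2 * (4 + MvPolynomial.X 2) +
    1024 ^ 2 * MvPolynomial.X 1 ^ 4 * MvPolynomial.X 0 ^ 2

theorem eval_samplePoly (x y z : ℝ) :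
    MvPolynomial.eval ![x, y, z] samplePoly =
      256 * y ^ 2 * (4 + z) + 1024 ^ 2 * y ^ 4 * x ^ 2 := by
  simp [samplePoly]

/-- Bounding the logarithm by `√n` keeps the sample size requirement polynomial and free of `log n`
on the other side. -/
theorem log_two_mul_add_one_le {n : ℝ} (hn : 1 ≤ n) :
    Real.log (2 * n + 1) ≤ 4 * Real.sqrt n := by
  have h0 : 0 < Real.sqrt (2 * n + 1) := Real.sqrt_pos.2 (by linarith)
  have h1 : Real.log (2 * n + 1) = 2 * Real.log (Real.sqrt (2 * n + 1)) := by
    rw [Real.log_sqrt (by linarith)]; ring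
  have h2 := Real.log_le_sub_one_of_pos h0
  have h3 : Real.sqrt (2 * n + 1) ≤ 2 * Real.sqrt n := by
    rw [Real.sqrt_le_iff]
    refine ⟨by positivity, ?_⟩
    rw [mul_pow, Real.sq_sqrt (by linarith)]
    linarith
  linarith

/-- Half of `n` pays for `4 + log (K / δ)`, where `exp 4` absorbs the factor `24`. The other half
pays for `d log (2n + 1) ≤ 4d√n`, which is why `d` and `1 / Δ²` enter squared. -/
theorem sample_size_bound {n d Δ K δ : ℝ} (hd : 0 ≤ d) (hΔ : 0 < Δ) (hδ : 0 < δ)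
    (hδK : δ ≤ K) (hn1 : 1 ≤ n)
    (hn : 256 * (1 / Δ) ^ 2 * (4 + Real.log (K / δ)) + 1024 ^ 2 * (1 / Δ) ^ 4 * d ^ 2 ≤ n) :
    24 * K * Real.exp (d * Real.log (2 * n + 1) - n * Δ ^ 2 / 128) ≤ δ := by
  have hK : 0 < K := hδ.trans_le hδK
  set L := Real.log (K / δ) with hL
  have hL0 : 0 ≤ L := Real.log_nonneg (by rwa [one_le_div hδ])
  have hKL : K = δ * Real.exp L := by
    rw [hL, Real.exp_log (by positivity)]; field_simp
  have h24 : (24 : ℝ) ≤ Real.exp 4 := by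
    have h1 := Real.exp_one_gt_d9
    have h2 : Real.exp 4 = Real.exp 1 ^ 4 := by rw [← Real.exp_nat_mul]; norm_num
    rw [h2]
    calc (24 : ℝ) ≤ 2.7 ^ 4 := by norm_num
      _ ≤ _ := by gcongr; linarith
  have hlog := log_two_mul_add_one_le hn1
  set u := 1 / Δ with hu
  have hu0 : 0 < u := by positivity
  set r := Real.sqrt n with hr
  have hrn : r ^ 2 = n := Real.sq_sqrt (by linarith)
  have hr1 : 1024 * u ^ 2 * d ≤ r := by
    apply Real.le_sqrt_of_sq_le
    have : 0 ≤ 256 * u ^ 2 * (4 + L) := by positivity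
    nlinarith
  have h1 : 128 * u ^ 2 * (4 + L) ≤ n / 2 := by
    have : 0 ≤ 1024 ^ 2 * u ^ 4 * d ^ 2 := by positivity
    linarith
  have h2 : 128 * u ^ 2 * (d * (4 * r)) ≤ n / 2 := by
    have hr0 : 0 ≤ r := Real.sqrt_nonneg n
    have := mul_le_mul_of_nonneg_right hr1 hr0
    nlinarith
  have h3 : 4 + L + d * Real.log (2 * n + 1) ≤ n * Δ ^ 2 / 128 := by
    have h4 : d * Real.log (2 * n + 1) ≤ d * (4 * r) := by gcongr
    have h5 : u ^ 2 * Δ ^ 2 = 1 := by rw [hu]; field_simp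
    have h6 : 128 * u ^ 2 * (4 + L + d * (4 * r)) ≤ n := by linarith
    have h7 := mul_le_mul_of_nonneg_right h6 (sq_nonneg Δ)
    have h8 : 128 * u ^ 2 * (4 + L + d * (4 * r)) * Δ ^ 2 = 128 * (4 + L + d * (4 * r)) := by
      linear_combination (128 * (4 + L + d * (4 * r))) * h5
    linarith
  calc 24 * K * Real.exp (d * Real.log (2 * n + 1) - n * Δ ^ 2 / 128)
      ≤ Real.exp 4 * K * Real.exp (d * Real.log (2 * n + 1) - n * Δ ^ 2 / 128) := by gcongr
    _ = δ * Real.exp (4 + L + d * Real.log (2 * n + 1) - n * Δ ^ 2 / 128) := by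
      rw [hKL, show 4 + L + d * Real.log (2 * n + 1) - n * Δ ^ 2 / 128 =
        4 + L + (d * Real.log (2 * n + 1) - n * Δ ^ 2 / 128) by ring, Real.exp_add, Real.exp_add]
      ring
    _ ≤ δ * 1 := by
      gcongr
      rw [Real.exp_le_one_iff]
      linarith
    _ = δ := mul_one δ

/-- With probability at least `1 - δ`, a sample represents all events of the program up
to `Δ`. -/
theorem measure_not_representative_le {D : Measure (Data X p)} [IsProbabilityMeasure D]
    (M : Fin m → PerfMetric X p) {F : Set (Classifier X p)} {d : ℕ}
    (hF : IsMeasurableClass (D.map inputOf) F) (hd : ∀ B, Shatters F B → B.card ≤ d)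
    (hK : (1 : ℝ) ≤ ∑ i, (p i : ℝ)) {δ Δ : ℝ} (hδ : 0 < δ) (hδ1 : δ < 1) (hΔ : 0 < Δ) {N : ℕ}
    (hN : MvPolynomial.eval ![(d : ℝ), 1 / Δ, Real.log ((∑ i, (p i : ℝ)) / δ)] samplePoly ≤ N) :
    0 < N ∧ (Measure.pi fun _ : Fin N => D)
      {S | ∃ k, ∃ f ∈ F, Δ < |(empirical S).real (event (programEvent M k) f) -
        D.real (event (programEvent M k) f)|} ≤ ENNReal.ofReal δ := by
  rw [eval_samplePoly] at hN
  set K : ℝ := ∑ i, (p i : ℝ) with hKdef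
  have hL0 : 0 ≤ Real.log (K / δ) := Real.log_nonneg (by rw [one_le_div hδ]; linarith)
  have hN2 : 1024 * (1 / Δ) ^ 2 ≤ N := by
    have h1 : 0 ≤ (1 / Δ) ^ 2 * Real.log (K / δ) := by positivity
    have h2 : 0 ≤ 1024 ^ 2 * (1 / Δ) ^ 4 * (d : ℝ) ^ 2 := by positivity
    linarith
  have hN0 : 0 < N := by
    have : (0 : ℝ) < N := lt_of_lt_of_le (by positivity) hN2
    exact_mod_cast this
  refine ⟨hN0, ?_⟩
  have hN1 : (1 : ℝ) ≤ N := by exact_mod_cast hN0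
  have hNΔ : 1024 ≤ N * Δ ^ 2 := by
    rw [div_pow, one_pow, ← mul_div_assoc, mul_one, div_le_iff₀ (by positivity)] at hN2
    exact hN2
  have h := measure_family_deviation_le (N := N) hF hd (measurableSet_programEvent M)
    (t := Δ / 4) (by positivity) (by nlinarith)
  rw [show 4 * (Δ / 4) = Δ by ring] at h
  refine h.trans (ENNReal.ofReal_le_ofReal ?_)
  -- One error event and two events for each pair `(r, l)` make `1 + 2K ≤ 3K`.
  have hcard : (Fintype.card (Option (Bool × Σ r : Fin m, Fin (p r))) : ℝ) ≤ 3 * K := by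
    simp only [Fintype.card_option, Fintype.card_prod, Fintype.card_bool, Fintype.card_sigma,
      Fintype.card_fin]
    push_cast
    linarith
  have hpow : (2 * (N : ℝ) + 1) ^ d * Real.exp (-(N * (Δ / 4) ^ 2 / 8)) =
      Real.exp (d * Real.log (2 * N + 1) - N * Δ ^ 2 / 128) := by
    rw [sub_eq_add_neg, Real.exp_add, Real.exp_nat_mul, Real.exp_log (by positivity)]
    ring_nf
  calc _ ≤ 3 * K * (8 * (2 * (N : ℝ) + 1) ^ d * Real.exp (-(N * (Δ / 4) ^ 2 / 8))) := by gcongr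
    _ = 24 * K * ((2 * (N : ℝ) + 1) ^ d * Real.exp (-(N * (Δ / 4) ^ 2 / 8))) := by ring
    _ ≤ δ := by
      rw [hpow]
      exact sample_size_bound (Nat.cast_nonneg d) hΔ hδ (by linarith) hN1 hN

end FairClass

end

/-! ### The main theorem: sampling error and adversary combined. -/

theorem mainTheorem5 :
    -- the polynomial that bounds the sample size depends on nothing
    ∃ Q : MvPolynomial (Fin 3) ℝ,
      ∀ (X : Type*) [MeasurableSpace X] (m : ℕ) (p : Fin m → ℕ)
        (D : Measure (FairClass.Data X p)) [IsProbabilityMeasure D]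
        (M : Fin m → FairClass.PerfMetric X p) (F : Set (FairClass.Classifier X p))
        (d : ℕ) (τ lam η ε ν δ Δ : ℝ) (fstar : FairClass.Classifier X p),
        0 < m →
        FairClass.IsMeasurableClass (D.map FairClass.inputOf) F →
        FairClass.HasVCDim F d →
        0 < τ → τ ≤ 1 →
        FairClass.IsErrMinimizer D (FairClass.fairSet D M F τ) fstar →
        0 < lam →
        (∀ r l, lam ≤ FairClass.jointProb D (M r) r fstar l) →
        0 < η → η < lam / 2 →
        2 * η < ε →
        8 * η * τ / (lam - 2 * η) < ν →
        0 < δ → δ < 1 →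
        0 < Δ →
        Δ ≤ 1 / 96 * min (ε - 2 * η)
          (min ((lam - 2 * η) * (ν - 8 * η * τ / (lam - 2 * η))) (lam - 2 * η)) →
        ∀ N : ℕ,
          MvPolynomial.eval ![(d : ℝ), 1 / Δ, Real.log ((∑ i, (p i : ℝ)) / δ)] Q ≤ N →
          -- iid samples `S`, perturbed to `S'` by an adversary who may use extra randomness
          ∀ (Ω : Type*) [MeasurableSpace Ω] (P : Measure Ω) [IsProbabilityMeasure P]
            (S S' : Fin N → Ω → FairClass.Data X p),
            (∀ i, HasLaw (S i) D P) → iIndepFun S P →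
            (∀ ω, FairClass.IsHammingPerturbation η (fun i => S i ω) (fun i => S' i ω)) →
            ∃ G : Set Ω, MeasurableSet G ∧ 1 - δ ≤ P.real G ∧ ∀ ω ∈ G,
              (∃ f, FairClass.IsErrTolerantSolution (fun i => S' i ω) M F τ η lam Δ f) ∧
              ∀ f, FairClass.IsErrTolerantSolution (fun i => S' i ω) M F τ η lam Δ f →
                FairClass.err D f - FairClass.err D fstar ≤ ε ∧
                ∀ r, τ - ν ≤ FairClass.fairness D (M r) r f := by
  refine ⟨FairClass.samplePoly, ?_⟩
  intro X _ m p D _ M F d τ lam η ε ν δ Δ fstar hm hF hvc hτ hτ1 hstar hlam hstarJ hη hηlam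
    hε hν hδ hδ1 hΔ hΔle N hN Ω _ P _ S S' hlaw hindep hpert
  -- A probability measure lives on a nonempty space, and any data point has a value for each
  -- attribute.
  have hp : ∀ r, 0 < p r := fun r => by
    obtain ⟨w⟩ := nonempty_of_isProbabilityMeasure D
    exact (w.2.2 r).pos
  have hK : (1 : ℝ) ≤ ∑ i, (p i : ℝ) := by
    have h1 : (1 : ℝ) ≤ p ⟨0, hm⟩ := by exact_mod_cast hp _
    exact h1.trans (Finset.single_le_sum (f := fun i => (p i : ℝ))
      (fun i _ => Nat.cast_nonneg _) (Finset.mem_univ _))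
  have hd : ∀ B, FairClass.Shatters F B → B.card ≤ d := fun B hB => hvc.2 ⟨B, rfl, hB⟩
  obtain ⟨hN0, hbad⟩ := FairClass.measure_not_representative_le M hF hd hK hδ hδ1 hΔ hN
  set B : Set (Fin N → FairClass.Data X p) := {S | ∃ k, ∃ f ∈ F,
    Δ < |(FairClass.empirical S).real (FairClass.event (FairClass.programEvent M k) f) -
      D.real (FairClass.event (FairClass.programEvent M k) f)|} with hB
  have hae : ∀ i, AEMeasurable (S i) P := fun i => (hlaw i).aemeasurable
  have hjoint : P.map (fun ω i => S i ω) = Measure.pi fun _ => D := by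
    rw [(iIndepFun_iff_map_fun_eq_pi_map hae).1 hindep]
    simp only [(hlaw _).map_eq]
  have hPB : P ((fun ω i => S i ω) ⁻¹' B) ≤ ENNReal.ofReal δ := by
    rw [← hjoint] at hbad
    exact (le_of_le_of_eq (measure_mono (Set.preimage_mono (subset_toMeasurable _ B)))
      (Measure.map_apply_of_aemeasurable (aemeasurable_pi_lambda _ hae)
        (measurableSet_toMeasurable _ B)).symm).trans
      ((measure_toMeasurable B).trans_le hbad)
  -- The bad set need not be measurable, so its hull is removed. It involves only the clean sample,
  -- so no measurability or independence of `S'` is needed.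
  refine ⟨(toMeasurable P ((fun ω i => S i ω) ⁻¹' B))ᶜ,
    (measurableSet_toMeasurable _ _).compl, ?_, fun ω hω => ?_⟩
  · rw [probReal_compl_eq_one_sub (measurableSet_toMeasurable _ _), measureReal_def,
      measure_toMeasurable]
    exact sub_le_sub_left (ENNReal.toReal_le_of_le_ofReal hδ.le hPB) 1
  · have hωB : (fun i => S i ω) ∉ B := fun h => hω (subset_toMeasurable P _ h)
    have hmin : ∀ y ∈ ({ε - 2 * η, (lam - 2 * η) * (ν - 8 * η * τ / (lam - 2 * η)),
        lam - 2 * η} : Set ℝ), 96 * Δ ≤ y := by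
      rintro y (rfl | rfl | rfl)
      · linarith [min_le_left (ε - 2 * η)
          (min ((lam - 2 * η) * (ν - 8 * η * τ / (lam - 2 * η))) (lam - 2 * η))]
      · linarith [(min_le_right (ε - 2 * η)
          (min ((lam - 2 * η) * (ν - 8 * η * τ / (lam - 2 * η))) (lam - 2 * η))).trans
          (min_le_left _ _)]
      · linarith [(min_le_right (ε - 2 * η)
          (min ((lam - 2 * η) * (ν - 8 * η * τ / (lam - 2 * η))) (lam - 2 * η))).trans
          (min_le_right _ _)]
    refine FairClass.errTolerant_of_representative hp hF.measurable hτ hτ1 hstar hstarJ hη hηlam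
      hΔ (hmin _ (by simp)) (hmin _ (by simp)) (hmin _ (by simp)) fun k f hf => ?_
    have h1 := (hpert ω).abs_empirical_sub_le hN0 (FairClass.measurableSet_event
      (FairClass.measurableSet_programEvent M k) (hF.measurable f hf))
    have h2 : |(FairClass.empirical fun i => S i ω).real
        (FairClass.event (FairClass.programEvent M k) f) -
        D.real (FairClass.event (FairClass.programEvent M k) f)| ≤ Δ :=
      not_lt.1 fun h => hωB ⟨k, f, hf, h⟩
    -- The adversary contributes `η` and the sampling contributes `Δ`.
    exact (abs_sub_le _ _ _).trans (add_le_add h1 h2)
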